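/- Let $q\ge 3$ be a prime power. There is $\varepsilon_0=\varepsilon_0(q)>0$ such that for every $K>0$ there is $c=c(q,K)>0$ with the following property. Let $0<\varepsilon\le\varepsilon_0$, let $n,N\ge 0$ be integers, and let $R$ be a multiset of $N$ points $x_1,\dots,x_N$ of $\mathbb F_q^n$ with $N\le K n^{q-1}$ (that is, $N=O(n^{q-1})$) that is $\varepsilon$-pseudorandom for polynomials of degree $q-1$: for every $p\in\mathbb F_q[X_1,\dots,X_n]$ of total degree at most $q-1$, $$\sum_{a\in\mathbb F_q}\Big|\Pr_{x\sim R}[p(x)=a]-\Pr_{x\sim\mathbb F_q^n}[p(x)=a]\Big|\le\varepsilon .$$ Let $\Psi$ be a Max NAND instance with $n$ variables, i.e. a finite family of $m$ equations over $\mathbb F_2$, each of the form $x_k=1+x_i\cdot x_j$, and let $r\ge 1$ be an integer. Then the code $\mathcal C(\Psi)\subseteq\mathbb F_q^{(qN)^2+4rm}$ defined below satisfies $$\dim \mathcal C(\Psi)\ \ge\ c\,N^2\qquad\text{and}\qquad d(\mathcal C(\Psi))\ \ge\ N^2,$$ where $d$ is the minimum Hamming weight of a non-zero codeword. **Definition of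 $\mathcal C(\Psi)$.** For $1\le d\le q-1$ let $P_d\subseteq\mathbb F_q^N$ be the space of all vectors $(p(x_1),\dots,p(x_N))$ with $p\in\mathbb F_q[X_1,\dots,X_n]$, $\deg p\le d$ and $p(0)=0$; let $P_0$ be the space of constant vectors. For linear codes $C_1,C_2\subseteq\mathbb F_q^N$ let $C_1\otimes C_2$ be the set of $N\times N$ matrices all of whose columns lie in $C_1$ and all of whose rows lie in $C_2$. For $\alpha\in\mathbb F_q^n$ let $C(\alpha)\in P_1$ be the vector of values of $\sum_i\alpha_iX_i$ at $x_1,\dots,x_N$. The linear code $\mathcal C'(\Psi)$ has as variables: vectors $Y^e\in\mathbb F_q^N$ for $0\le e\le 2(q-1)$; matrices $Y^{e,f}\in\mathbb F_q^{N\times N}$ for $0\le e,f\le q-1$; functions $Z_{ij}:\mathbb F_q^2\to\mathbb F_q$ for $1\le i,j\le N$; and for every equation $x_k=1+x_i\cdot x_j$ of $\Psi$ a function $S_{ijk}:\mathbb F_2^2\to\mathbb F_q$. Its constraints are (with $0^0=1$): 1. $Y^e\in P_e$ for $0\le e\le q-1$, and $Y^e=Y^{e-(q-1)}$ for $q\le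 e\le 2(q-1)$. 2. For $0\le e,f\le q-1$: $Y^{e,f}\in P_e\otimes P_f$, and the diagonal of $Y^{e,f}$ equals $Y^{e+f}$. 3. For $0\le e\le q-1$ the rows of $Y^{0,e}$ are identical and the columns of $Y^{e,0}$ are identical. In particular all entries of $Y^{0,0}$ are equal; let $Y_0$ be their common value. 4. $Y^{q-1,q-1}$ is symmetric. 5. With $\alpha\in\mathbb F_q^n$ such that $Y^1=C(\alpha)$, for every equation $x_k=1+x_i\cdot x_j$ of $\Psi$, $$Y_0=\sum_{a,b\in\mathbb F_2}S_{ijk}(a,b),\quad \alpha_i=\sum_{a,b\in\mathbb F_2}a\,S_{ijk}(a,b),\quad \alpha_j=\sum_{a,b\in\mathbb F_2}b\,S_{ijk}(a,b),\quad \alpha_k=\sum_{a,b\in\mathbb F_2}(1\oplus ab)\,S_{ijk}(a,b),$$ where $\oplus$ is addition in $\mathbb F_2$, elements of $\mathbb F_2=\{0,1\}$ are regarded as elements of $\mathbb F_q$, and the remaining operations are in $\mathbb F_q$. 6. For all $1\le i,j\le N$ and $0\le e,f\le q-1$: $Y^{e,f}(i,j)=\sum_{x,y\in\mathbb F_q}x^ey^fZ_{ij}(x,y)$.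 Finally, $\mathcal C(\Psi)$ is the projection of $\mathcal C'(\Psi)$ to the functions $Z_{ij}$ and $S_{ijk}$, with each $S_{ijk}$ repeated $r$ times. -/

import Mathlib

namespace GoodCode

/-- A Max NAND instance on `n` variables: a finite family of `m` equations over `𝔽₂`;
equation `t` reads `x_{out t} = 1 + x_{fst t} * x_{snd t}`. -/
structure MaxNAND (n : ℕ) where
  m : ℕ
  fst : Fin m → Fin n
  snd : Fin m → Fin n
  out : Fin m → Fin n

/-- The distance of a linear code: the minimum Hamming weight of a non-zero codeword
(`⊤` for the zero code, where there is no non-zero codeword). -/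
noncomputable def distance {F ι : Type*} [Field F] [DecidableEq F] [Fintype ι]
    (C : Submodule F (ι → F)) : ℕ∞ :=
  ⨅ w ∈ {w : ι → F | w ∈ C ∧ w ≠ 0}, (hammingNorm w : ℕ∞)

/-- `C₁ ⊗ C₂`: the matrices all of whose columns lie in `C₁` and all of whose rows lie in `C₂`. -/
def tensorCode {F : Type*} [Field F] {N : ℕ} (C₁ C₂ : Submodule F (Fin N → F)) :
    Submodule F (Matrix (Fin N) (Fin N) F) where
  carrier := {Y | (∀ j, (fun i => Y i j) ∈ C₁) ∧ (∀ i, (fun j => Y i j) ∈ C₂)}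
  add_mem' ha hb := ⟨fun j => C₁.add_mem (ha.1 j) (hb.1 j), fun i => C₂.add_mem (ha.2 i) (hb.2 i)⟩
  zero_mem' := ⟨fun _ => C₁.zero_mem, fun _ => C₂.zero_mem⟩
  smul_mem' c _ ha := ⟨fun j => C₁.smul_mem c (ha.1 j), fun i => C₂.smul_mem c (ha.2 i)⟩

/-- The multiset `R` of points of `F^n` (listed as a family indexed by `Fin N`) is
`ε`-pseudorandom for polynomials of total degree at most `d`: the value of such a polynomial at a
uniform element of `R` and at a uniform element of `F^n` have distributions at `ℓ¹`-distance at
most `ε`. -/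
def IsPseudorandom {F : Type*} [Field F] [Fintype F] [DecidableEq F] {n N : ℕ}
    (R : Fin N → Fin n → F) (d : ℕ) (ε : ℝ) : Prop :=
  ∀ p : MvPolynomial (Fin n) F, p.totalDegree ≤ d →
    ∑ a : F,
      |((Finset.univ.filter fun t : Fin N => MvPolynomial.eval (R t) p = a).card : ℝ) / (N : ℝ)
        - ((Finset.univ.filter fun x : Fin n → F => MvPolynomial.eval x p = a).card : ℝ)
          / (Fintype.card F : ℝ) ^ n| ≤ ε

/-- `P_d`: for `d ≥ 1`, the vectors `(p(x))_{x ∈ R}` with `p` of total degree at most `d` and without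
constant term; `P_0` is the space of constant vectors. -/
def polyCode {F : Type*} [Field F] {n N : ℕ} (R : Fin N → Fin n → F) (d : ℕ) :
    Submodule F (Fin N → F) where
  carrier := {v | ∃ p : MvPolynomial (Fin n) F, p.totalDegree ≤ d ∧
    (1 ≤ d → MvPolynomial.eval 0 p = 0) ∧ ∀ t, v t = MvPolynomial.eval (R t) p}
  add_mem' := by
    rintro v w ⟨p, hp, hp0, hpv⟩ ⟨p', hp', hp0', hpv'⟩
    refine ⟨p + p', (MvPolynomial.totalDegree_add _ _).trans (max_le hp hp'), fun h => ?_,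
      fun t => ?_⟩
    · rw [map_add, hp0 h, hp0' h, add_zero]
    · rw [map_add, Pi.add_apply, hpv, hpv']
  zero_mem' := ⟨0, by simp, by simp, by simp⟩
  smul_mem' := by
    rintro c v ⟨p, hp, hp0, hpv⟩
    refine ⟨c • p, (MvPolynomial.totalDegree_smul_le _ _).trans hp, fun h => ?_, fun t => ?_⟩
    · rw [MvPolynomial.smul_eval, hp0 h, mul_zero]
    · rw [MvPolynomial.smul_eval, Pi.smul_apply, hpv, smul_eq_mul]

/-- `C(α)`: the evaluations of the linear polynomial `∑ i, α i * X i` at the points of `R`. -/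
def encode {F : Type*} [Field F] {n N : ℕ} (R : Fin N → Fin n → F) (α : Fin n → F) : Fin N → F :=
  fun t => ∑ i, α i * R t i

/-- The variables of the big code: vectors `Y^e` for `0 ≤ e ≤ 2(q-1)`, matrices `Y^{e,f}` for
`0 ≤ e, f ≤ q-1`, functions `Z_{ij} : F² → F` for `i, j ∈ [N]`, and one function
`S_t : 𝔽₂² → F` for every equation `t`. -/
abbrev Vars (F : Type*) [Fintype F] (N m : ℕ) : Type _ :=
  (Fin (2 * (Fintype.card F - 1) + 1) → Fin N → F) ×
  (Fin (Fintype.card F) → Fin (Fintype.card F) → Matrix (Fin N) (Fin N) F) ×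
  (Fin N → Fin N → F → F → F) ×
  (Fin m → ZMod 2 → ZMod 2 → F)

/-- An element of `𝔽₂ = {0, 1}` regarded as an element of `F`. -/
def bit (F : Type*) [Field F] (a : ZMod 2) : F := (a.val : F)

/-- The constraints of the big code. -/
structure Constraints {F : Type*} [Field F] [Fintype F] {n N : ℕ}
    (R : Fin N → Fin n → F) (Ψ : MaxNAND n)
    (V : Fin (2 * (Fintype.card F - 1) + 1) → Fin N → F)
    (Y : Fin (Fintype.card F) → Fin (Fintype.card F) → Matrix (Fin N) (Fin N) F)
    (Z : Fin N → Fin N → F → F → F)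
    (S : Fin Ψ.m → ZMod 2 → ZMod 2 → F) : Prop where
  vec_mem : ∀ e : Fin (2 * (Fintype.card F - 1) + 1), (e : ℕ) ≤ Fintype.card F - 1 → V e ∈ polyCode R (e : ℕ)
  vec_reduce : ∀ e e' : Fin (2 * (Fintype.card F - 1) + 1), Fintype.card F ≤ (e : ℕ) →
    (e' : ℕ) = (e : ℕ) - (Fintype.card F - 1) → V e = V e'
  mat_mem : ∀ e f : Fin (Fintype.card F), Y e f ∈ tensorCode (polyCode R (e : ℕ)) (polyCode R (f : ℕ))
  mat_diag : ∀ (e f : Fin (Fintype.card F)) (g : Fin (2 * (Fintype.card F - 1) + 1)),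
    (g : ℕ) = (e : ℕ) + (f : ℕ) → (Y e f).diag = V g
  rows_eq : ∀ z e : Fin (Fintype.card F), (z : ℕ) = 0 → ∀ i i' j, Y z e i j = Y z e i' j
  cols_eq : ∀ e z : Fin (Fintype.card F), (z : ℕ) = 0 → ∀ i j j', Y e z i j = Y e z i j'
  mat_symm : ∀ e : Fin (Fintype.card F), (e : ℕ) = Fintype.card F - 1 → (Y e e).transpose = Y e e
  /-- `y₀` is the common value of the entries of `Y^{0,0}`, and `α` is the decoding of `Y^1`. -/
  nand_check : ∃ (y₀ : F) (α : Fin n → F),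
    (∀ z : Fin (Fintype.card F), (z : ℕ) = 0 → ∀ i j, Y z z i j = y₀) ∧
    (∀ e : Fin (2 * (Fintype.card F - 1) + 1), (e : ℕ) = 1 → V e = encode R α) ∧
    ∀ t,
      y₀ = ∑ a, ∑ b, S t a b ∧
      α (Ψ.fst t) = ∑ a, ∑ b, bit F a * S t a b ∧
      α (Ψ.snd t) = ∑ a, ∑ b, bit F b * S t a b ∧
      α (Ψ.out t) = ∑ a, ∑ b, bit F (1 + a * b) * S t a b
  prod_check : ∀ (i j : Fin N) (e f : Fin (Fintype.card F)),
    Y e f i j = ∑ x : F, ∑ y : F, x ^ (e : ℕ) * y ^ (f : ℕ) * Z i j x y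

/-- The big code `C'(Ψ)`, in all the variables. -/
def bigCode {F : Type*} [Field F] [Fintype F] {n N : ℕ} (R : Fin N → Fin n → F)
    (Ψ : MaxNAND n) : Submodule F (Vars F N Ψ.m) where
  carrier := {w | Constraints R Ψ w.1 w.2.1 w.2.2.1 w.2.2.2}
  add_mem' := by
    rintro ⟨V, Y, Z, S⟩ ⟨V', Y', Z', S'⟩ h h'
    change Constraints R Ψ V Y Z S at h
    change Constraints R Ψ V' Y' Z' S' at h'
    change Constraints R Ψ (V + V') (Y + Y') (Z + Z') (S + S')
    constructor <;> simp only [Pi.add_apply, Matrix.add_apply]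
    · exact fun e he => Submodule.add_mem _ (h.vec_mem e he) (h'.vec_mem e he)
    · intro e e' h1 h2
      rw [h.vec_reduce e e' h1 h2, h'.vec_reduce e e' h1 h2]
    · exact fun e f => Submodule.add_mem _ (h.mat_mem e f) (h'.mat_mem e f)
    · intro e f g hg
      rw [Matrix.diag_add, h.mat_diag e f g hg, h'.mat_diag e f g hg]
    · intro z e hz i i' j
      rw [h.rows_eq z e hz i i' j, h'.rows_eq z e hz i i' j]
    · intro e z hz i j j'
      rw [h.cols_eq e z hz i j j', h'.cols_eq e z hz i j j']
    · intro e he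
      rw [Matrix.transpose_add, h.mat_symm e he, h'.mat_symm e he]
    · obtain ⟨y, α, h1, h2, h3⟩ := h.nand_check
      obtain ⟨y', α', h1', h2', h3'⟩ := h'.nand_check
      refine ⟨y + y', α + α', fun z hz i j => ?_, fun e he => ?_, fun t => ?_⟩
      · rw [h1 z hz, h1' z hz]
      · rw [h2 e he, h2' e he]
        funext t
        simp [encode, add_mul, Finset.sum_add_distrib]
      · obtain ⟨a1, a2, a3, a4⟩ := h3 t
        obtain ⟨b1, b2, b3, b4⟩ := h3' t
        simp only [Pi.add_apply, mul_add, Finset.sum_add_distrib]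
        exact ⟨by rw [a1, b1], by rw [a2, b2], by rw [a3, b3], by rw [a4, b4]⟩
    · intro i j e f
      simp only [mul_add, Finset.sum_add_distrib]
      rw [h.prod_check i j e f, h'.prod_check i j e f]
  zero_mem' := by
    constructor
    · exact fun e _ => Submodule.zero_mem _
    · exact fun _ _ _ _ => rfl
    · exact fun e f => Submodule.zero_mem _
    · exact fun _ _ _ _ => rfl
    · exact fun _ _ _ _ _ _ => rfl
    · exact fun _ _ _ _ _ _ => rfl
    · exact fun _ _ => rfl
    · refine ⟨0, 0, fun _ _ _ _ => rfl, fun e _ => ?_, fun t => ?_⟩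
      · funext t
        simp [encode]
      · simp
    · intro i j e f
      simp
  smul_mem' := by
    rintro c ⟨V, Y, Z, S⟩ h
    change Constraints R Ψ V Y Z S at h
    change Constraints R Ψ (c • V) (c • Y) (c • Z) (c • S)
    constructor <;> simp only [Pi.smul_apply, Matrix.smul_apply]
    · exact fun e he => Submodule.smul_mem _ c (h.vec_mem e he)
    · intro e e' h1 h2
      rw [h.vec_reduce e e' h1 h2]
    · exact fun e f => Submodule.smul_mem _ c (h.mat_mem e f)
    · intro e f g hg
      rw [Matrix.diag_smul, h.mat_diag e f g hg]
    · intro z e hz i i' j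
      rw [h.rows_eq z e hz i i' j]
    · intro e z hz i j j'
      rw [h.cols_eq e z hz i j j']
    · intro e he
      rw [Matrix.transpose_smul, h.mat_symm e he]
    · obtain ⟨y, α, h1, h2, h3⟩ := h.nand_check
      refine ⟨c * y, c • α, fun z hz i j => ?_, fun e he => ?_, fun t => ?_⟩
      · rw [h1 z hz, smul_eq_mul]
      · rw [h2 e he]
        funext t
        simp [encode, Finset.mul_sum, mul_assoc]
      · obtain ⟨a1, a2, a3, a4⟩ := h3 t
        simp only [Pi.smul_apply, smul_eq_mul, mul_left_comm _ c, ← Finset.mul_sum]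
        exact ⟨by rw [a1], by rw [a2]; simp only [Finset.mul_sum], by rw [a3], by rw [a4]⟩
    · intro i j e f
      simp only [smul_eq_mul, mul_left_comm _ c, ← Finset.mul_sum]
      rw [h.prod_check i j e f]

/-- The `(qN)² + 4rm` coordinates of the final code: those of the `Z_{ij}`, and `r` copies of those
of the `S_t`. -/
abbrev Coord (F : Type*) (N m r : ℕ) : Type _ :=
  (Fin N × Fin N × F × F) ⊕ (Fin r × Fin m × ZMod 2 × ZMod 2)

/-- The projection to the coordinates `Z_{ij}` and `S_t`, each `S_t` being repeated `r` times. -/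
def proj (F : Type*) [Field F] [Fintype F] (N m r : ℕ) :
    Vars F N m →ₗ[F] (Coord F N m r → F) where
  toFun w := Sum.elim (fun c => w.2.2.1 c.1 c.2.1 c.2.2.1 c.2.2.2)
    (fun c => w.2.2.2 c.2.1 c.2.2.1 c.2.2.2)
  map_add' w w' := by
    funext c
    rcases c with c | c <;> rfl
  map_smul' a w := by
    funext c
    rcases c with c | c <;> rfl

/-- The final code `C(Ψ)`. -/
def finalCode {F : Type*} [Field F] [Fintype F] {n N : ℕ} (R : Fin N → Fin n → F)
    (Ψ : MaxNAND n) (r : ℕ) : Submodule F (Coord F N Ψ.m r → F) :=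
  (bigCode R Ψ).map (proj F N Ψ.m r)

end GoodCode

/-!
Throughout, `q` is the size of the field `F`, and `ε ≤ 1 / (4 q²)`.

Distance. By Schwartz–Zippel and pseudorandomness, a non-zero word of `P_d` with `d ≤ q - 1` has
relative weight at least `1 - d/q - ε` (`IsPseudorandom.le_hammingNorm_of_mem_polyCode`), so a non-zero
`Y^{e,f}` has at least `(1 - e/q - ε)(1 - f/q - ε) N²` non-zero entries. The entries `Y^{e,f}(i,j)` are
the moments of `Z_{ij}`; if `(e, f)` is lexicographically the first exponent pair with a non-zero
moment, then `Z_{ij}` has at least `(e + 1)(f + 1)` non-zero values (`mul_le_weight_of_moment`). Take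
`(e, f)` to be the lexicographically first pair with `Y^{e,f} ≠ 0`. Up to `ε`, the product of the two
bounds is `N²` times `(e + 1)(q - e)/q · (f + 1)(q - f)/q`, which exceeds `N²` by a constant factor
unless both exponents lie in `{0, q - 1}`. These corners are where the other constraints enter:

* if `Y^{0,0} ≠ 0`, then no `Z_{ij}` vanishes;
* `(q - 1, 0)` is impossible, because `Y^{q-1,0}` has identical columns and the diagonal of
  `Y^{0,q-1}`;
* for `(0, q - 1)`, the diagonal forces `Y^{1,q-2} ≠ 0` (here `q ≥ 3` is used), and one counts over the
  first non-zero `Y^{1,f}` instead (`Constraints.sq_le_of_zero_top`);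
* for `(q - 1, q - 1)`, the matrix is symmetric with zero diagonal, hence of rank at least two, and
  this improves the count by a factor `1 + 1/q` (`Constraints.sq_le_of_top_top`).

Dimension. A symmetric matrix with zero diagonal and rows in `P_{q-1}` gives a codeword, with constant
functions `Z_{ij}` (`map_constWord_le_finalCode`). The monomials of degree `q - 1`, of which there are at
least `n^{q-1} / (q-1)!`, have linearly independent words; symmetrised products of words from two
disjoint halves of them span a space of dimension quadratic in `N`, on which the zero diagonal imposes
only `N` conditions (`sq_le_finrank_symmZeroDiag_add`). For bounded `N` one non-zero matrix suffices, and
the indicators of two parallel hyperplanes supply it (`one_le_finrank_symmZeroDiag`).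
-/

namespace GoodCode
open Finset

/-! ### Supports of functions with vanishing moments -/

section Moments

variable {F : Type*} [Field F] [Fintype F]

lemma sum_polynomial_eval_mul (P : Polynomial F) (g : F → F) {k : ℕ}
    (hP : P.natDegree ≤ k) (hg : ∀ e < k, ∑ x, x ^ e * g x = 0) :
    ∑ x, P.eval x * g x = P.coeff k * ∑ x, x ^ k * g x := by
  simp_rw [Polynomial.eval_eq_sum_range' (Nat.lt_succ_of_le hP), Finset.sum_mul]
  rw [Finset.sum_comm, Finset.sum_range_succ, Finset.sum_eq_zero, zero_add, Finset.mul_sum]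
  · exact Finset.sum_congr rfl fun x _ => mul_assoc _ _ _
  · intro e he
    simp_rw [mul_assoc, ← Finset.mul_sum]
    rw [hg e (Finset.mem_range.1 he), mul_zero]

/-- The two-variable moment of `Z : F → F → F` with exponents `e` and `f`. -/
def moment (Z : F → F → F) (e f : ℕ) : F := ∑ x : F, ∑ y : F, x ^ e * y ^ f * Z x y

lemma moment_eq (Z : F → F → F) (e f : ℕ) :
    moment Z e f = ∑ y, y ^ f * ∑ x, x ^ e * Z x y := by
  rw [moment, Finset.sum_comm]
  refine Finset.sum_congr rfl fun y _ => ?_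
  rw [Finset.mul_sum]
  exact Finset.sum_congr rfl fun x _ => by ring

variable [DecidableEq F]

/-- A function whose first non-vanishing moment is the `k`-th has more than `k` non-zero values:
otherwise a monic polynomial of degree `k` vanishes on its support. -/
lemma lt_hammingNorm_of_moments (g : F → F) {k : ℕ} (hg : ∀ e < k, ∑ x, x ^ e * g x = 0)
    (hk : ∑ x, x ^ k * g x ≠ 0) : k + 1 ≤ hammingNorm g := by
  by_contra! h
  set s : Finset F := {x | g x ≠ 0} with hs
  have hcard : s.card ≤ k := by
    have : hammingNorm g = s.card := rfl
    omega
  set P : Polynomial F := (∏ a ∈ s, (Polynomial.X - Polynomial.C a)) * Polynomial.X ^ (k - s.card)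
    with hPdef
  have hprod : (∏ a ∈ s, (Polynomial.X - Polynomial.C a)).Monic :=
    Polynomial.monic_prod_of_monic _ _ fun a _ => Polynomial.monic_X_sub_C a
  have hmonic : P.Monic := hprod.mul (Polynomial.monic_X_pow _)
  have hdeg : P.natDegree = k := by
    rw [hPdef, hprod.natDegree_mul (Polynomial.monic_X_pow _), Polynomial.natDegree_X_pow,
      Polynomial.natDegree_finsetProd_X_sub_C_eq_card]
    omega
  have h1 := sum_polynomial_eval_mul P g hdeg.le hg
  have hlead : P.coeff k = 1 := by
    rw [← hdeg]; exact hmonic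
  rw [hlead, one_mul, Finset.sum_eq_zero] at h1
  · exact hk h1.symm
  · intro x _
    by_cases hx : g x = 0
    · rw [hx, mul_zero]
    · rw [hPdef, Polynomial.eval_mul, Polynomial.eval_prod, Finset.prod_eq_zero (i := x),
        zero_mul, zero_mul]
      · simpa [hs] using hx
      · simp

lemma eq_zero_of_moments (g : F → F) (hg : ∀ e < Fintype.card F, ∑ x, x ^ e * g x = 0) :
    g = 0 := by
  by_contra hne
  have : ∃ e, ∑ x, x ^ e * g x ≠ 0 := by
    by_contra! hall
    obtain ⟨x₀, hx₀⟩ := Function.ne_iff.1 hne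
    have h1 := sum_polynomial_eval_mul (∏ a ∈ univ.erase x₀, (Polynomial.X - Polynomial.C a)) g
      le_rfl (fun e _ => hall e)
    rw [hall, mul_zero, Finset.sum_eq_single x₀] at h1
    · refine mul_ne_zero ?_ hx₀ h1
      rw [Polynomial.eval_prod, Finset.prod_ne_zero_iff]
      intro a ha
      simpa [sub_eq_zero] using (Finset.ne_of_mem_erase ha).symm
    · intro b _ hb
      rw [Polynomial.eval_prod, Finset.prod_eq_zero (i := b), zero_mul]
      · simpa using hb
      · simp
    · simp
  classical
  have h1 := lt_hammingNorm_of_moments g (k := Nat.find this)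
    (fun e he => not_not.1 (Nat.find_min this he)) (Nat.find_spec this)
  have h2 : hammingNorm g ≤ Fintype.card F := hammingNorm_le_card_fintype
  exact Nat.find_spec this (hg _ (by omega))

lemma eq_zero_of_moment_eq_zero (Z : F → F → F)
    (hZ : ∀ e < Fintype.card F, ∀ f < Fintype.card F, moment Z e f = 0) : Z = 0 := by
  funext x y
  have h : ∀ e < Fintype.card F, ∑ x, x ^ e * Z x y = 0 := fun e he =>
    congrFun (eq_zero_of_moments (fun y => ∑ x, x ^ e * Z x y)
      fun f hf => by rw [← moment_eq]; exact hZ e he f hf) y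
  exact congrFun (eq_zero_of_moments (fun x => Z x y) h) x

/-- The number of non-zero values of `Z : F → F → F`, counted column by column. -/
def weight (Z : F → F → F) : ℕ := ∑ y, hammingNorm fun x => Z x y

lemma one_le_weight {Z : F → F → F} (hZ : Z ≠ 0) : 1 ≤ weight Z := by
  obtain ⟨x, hx⟩ := Function.ne_iff.1 hZ
  obtain ⟨y, hy⟩ := Function.ne_iff.1 hx
  refine le_trans ?_ (Finset.single_le_sum (f := fun y => hammingNorm fun x => Z x y)
    (fun _ _ => Nat.zero_le _) (Finset.mem_univ y))
  exact Nat.one_le_iff_ne_zero.2 (hammingNorm_ne_zero_iff.2 (Function.ne_iff.2 ⟨x, hy⟩))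

/-- If `(e, f)` is lexicographically the first exponent pair with a non-zero moment, then `Z` has
at least `(e + 1) * (f + 1)` non-zero values. -/
lemma mul_le_weight_of_moment (Z : F → F → F) {e f : ℕ}
    (h1 : ∀ e' < e, ∀ f' < Fintype.card F, moment Z e' f' = 0)
    (h2 : ∀ f' < f, moment Z e f' = 0) (h3 : moment Z e f ≠ 0) :
    (e + 1) * (f + 1) ≤ weight Z := by
  have hzero : ∀ y, ∀ e' < e, ∑ x, x ^ e' * Z x y = 0 := fun y e' he' =>
    congrFun (eq_zero_of_moments (fun y => ∑ x, x ^ e' * Z x y)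
      fun f' hf' => by rw [← moment_eq]; exact h1 e' he' f' hf') y
  have hrow := lt_hammingNorm_of_moments (fun y => ∑ x, x ^ e * Z x y) (k := f)
    (fun f' hf' => by rw [← moment_eq]; exact h2 f' hf') (by rw [← moment_eq]; exact h3)
  calc (e + 1) * (f + 1) ≤ (e + 1) * hammingNorm (fun y => ∑ x, x ^ e * Z x y) :=
        Nat.mul_le_mul_left _ hrow
    _ = ∑ y with (∑ x, x ^ e * Z x y) ≠ 0, (e + 1) := by
        rw [Finset.sum_const, smul_eq_mul, mul_comm]; rfl
    _ ≤ ∑ y with (∑ x, x ^ e * Z x y) ≠ 0, hammingNorm (fun x => Z x y) :=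
        Finset.sum_le_sum fun y hy =>
          lt_hammingNorm_of_moments _ (hzero y) (Finset.mem_filter.1 hy).2
    _ ≤ weight Z := Finset.sum_le_sum_of_subset (Finset.filter_subset _ _)

end Moments

/-! ### Weights in tensor codes -/

section Tensor

variable {F : Type*} [Field F] [DecidableEq F] {N : ℕ}

/-- The number of non-zero rows times the minimum weight of a row bounds the number of non-zero
entries of a matrix from below. -/
lemma card_rows_mul_le (Y : Matrix (Fin N) (Fin N) F) {w : ℝ}
    (hrow : ∀ i, Y i ≠ 0 → w ≤ hammingNorm (Y i)) :
    (#{i | hammingNorm (Y i) ≠ 0} : ℝ) * w ≤ ∑ i, (hammingNorm (Y i) : ℝ) := by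
  rw [← nsmul_eq_mul, ← Finset.sum_const]
  calc ∑ i with hammingNorm (Y i) ≠ 0, w ≤ ∑ i with hammingNorm (Y i) ≠ 0, (hammingNorm (Y i) : ℝ) :=
        Finset.sum_le_sum fun i hi => hrow i (hammingNorm_ne_zero_iff.1 (Finset.mem_filter.1 hi).2)
    _ ≤ _ := Finset.sum_le_sum_of_subset_of_nonneg (Finset.filter_subset _ _)
        fun _ _ _ => Nat.cast_nonneg _

lemma mul_le_nnz_of_mem_tensorCode {C₁ C₂ : Submodule F (Fin N → F)} {w₁ w₂ : ℝ} (hw₂ : 0 ≤ w₂)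
    (h₁ : ∀ v ∈ C₁, v ≠ 0 → w₁ ≤ hammingNorm v) (h₂ : ∀ v ∈ C₂, v ≠ 0 → w₂ ≤ hammingNorm v)
    {Y : Matrix (Fin N) (Fin N) F} (hY : Y ∈ tensorCode C₁ C₂) (hne : Y ≠ 0) :
    w₁ * w₂ ≤ ∑ i, (hammingNorm (Y i) : ℝ) := by
  obtain ⟨i, hi⟩ := Function.ne_iff.1 hne
  obtain ⟨j, hj⟩ := Function.ne_iff.1 hi
  refine le_trans (mul_le_mul_of_nonneg_right ?_ hw₂)
    (card_rows_mul_le Y fun i hi => h₂ _ (hY.2 i) hi)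
  refine (h₁ _ (hY.1 j) (Function.ne_iff.2 ⟨i, hj⟩)).trans (Nat.cast_le.2 ?_)
  refine Finset.card_le_card fun k hk => ?_
  simp only [Finset.mem_filter, Finset.mem_univ, true_and] at hk ⊢
  exact hammingNorm_ne_zero_iff.2 (Function.ne_iff.2 ⟨j, hk⟩)

/-- Two words spanning a plane, all of whose non-zero words have weight at least `w`, have a joint
support of size at least `(1 + 1 / |F|) * w`: each position of it is zero in exactly one of the
words `v` and `u + c • v`. -/
lemma mul_le_card_joint_support [Fintype F] {u v : Fin N → F} {w : ℝ} (hv : w ≤ hammingNorm v)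
    (hu : ∀ c : F, w ≤ hammingNorm (u + c • v)) :
    ((Fintype.card F : ℝ) + 1) * w ≤ Fintype.card F * #{i | u i ≠ 0 ∨ v i ≠ 0} := by
  have hcount : hammingNorm v + ∑ c : F, hammingNorm (u + c • v) ≤
      Fintype.card F * #{i | u i ≠ 0 ∨ v i ≠ 0} := by
    simp only [hammingNorm, Finset.card_filter]
    rw [Finset.sum_comm, ← Finset.sum_add_distrib, Finset.mul_sum]
    refine Finset.sum_le_sum fun i _ => ?_
    by_cases hvi : v i = 0
    · by_cases hui : u i = 0 <;> simp [hvi, hui]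
    · have h : ∑ c : F, (if (u + c • v) i ≠ 0 then 1 else 0) ≤ Fintype.card F - 1 := by
        rw [← Finset.card_filter, ← Finset.card_univ, ← Finset.card_erase_of_mem
          (Finset.mem_univ (-(u i) / v i))]
        refine Finset.card_le_card fun c hc => ?_
        simp only [Finset.mem_filter, Finset.mem_erase, Finset.mem_univ, true_and, and_true] at hc ⊢
        rintro rfl
        apply hc
        simp [div_mul_cancel₀ _ hvi]
      have hpos : 0 < Fintype.card F := Fintype.card_pos
      simp only [hvi, ne_eq, not_false_eq_true, if_true, or_true, mul_one] at h ⊢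
      omega
  calc ((Fintype.card F : ℝ) + 1) * w = w + ∑ _c : F, w := by
        rw [Finset.sum_const, Finset.card_univ, nsmul_eq_mul]; ring
    _ ≤ hammingNorm v + ∑ c : F, (hammingNorm (u + c • v) : ℝ) :=
        add_le_add hv (Finset.sum_le_sum fun c _ => hu c)
    _ ≤ _ := by exact_mod_cast hcount

/-- A non-zero symmetric matrix with zero diagonal has rank at least two, whence the gain of
`1 + 1 / |F|` over the product bound for tensor codes. -/
lemma mul_le_nnz_of_symm_of_diag_eq_zero [Fintype F] {C : Submodule F (Fin N → F)} {w : ℝ}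
    (hw : 0 ≤ w) (h : ∀ v ∈ C, v ≠ 0 → w ≤ hammingNorm v) {Y : Matrix (Fin N) (Fin N) F}
    (hY : Y ∈ tensorCode C C) (hne : Y ≠ 0) (hsymm : Y.transpose = Y) (hdiag : Y.diag = 0) :
    ((Fintype.card F : ℝ) + 1) * w * w ≤ Fintype.card F * ∑ i, (hammingNorm (Y i) : ℝ) := by
  obtain ⟨a, ha⟩ := Function.ne_iff.1 hne
  obtain ⟨b, hab⟩ := Function.ne_iff.1 ha
  have hab : Y a b ≠ 0 := hab
  have hba : Y b a ≠ 0 := by rw [← hsymm]; exact hab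
  have haa : Y a a = 0 := congrFun hdiag a
  have hbb : Y b b = 0 := congrFun hdiag b
  -- The columns `a` and `b` span a plane: column `a` vanishes at `a` but not at `b`, and column `b`
  -- vanishes at `b` but not at `a`.
  have hsupp := mul_le_card_joint_support (u := fun i => Y i a) (v := fun i => Y i b)
    (h _ (hY.1 b) (Function.ne_iff.2 ⟨a, hab⟩))
    (fun c => h _ (C.add_mem (hY.1 a) (C.smul_mem c (hY.1 b)))
      (Function.ne_iff.2 ⟨b, by simpa [hbb] using hba⟩))
  have hrows : #{i | Y i a ≠ 0 ∨ Y i b ≠ 0} ≤ #{i | hammingNorm (Y i) ≠ 0} := by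
    refine Finset.card_le_card fun k hk => ?_
    simp only [Finset.mem_filter, Finset.mem_univ, true_and] at hk ⊢
    exact hammingNorm_ne_zero_iff.2
      (Function.ne_iff.2 (hk.elim (fun h => ⟨a, h⟩) fun h => ⟨b, h⟩))
  have hnn := card_rows_mul_le Y fun i hi => h _ (hY.2 i) hi
  calc ((Fintype.card F : ℝ) + 1) * w * w
      ≤ Fintype.card F * #{i | Y i a ≠ 0 ∨ Y i b ≠ 0} * w := mul_le_mul_of_nonneg_right hsupp hw
    _ ≤ Fintype.card F * #{i | hammingNorm (Y i) ≠ 0} * w := by gcongr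
    _ ≤ _ := by rw [mul_assoc]; gcongr

end Tensor

/-! ### Evaluations of polynomials at pseudorandom points -/

section Pseudorandom

variable {F : Type*} [Field F] [Fintype F] [DecidableEq F] {n N : ℕ} {R : Fin N → Fin n → F}
  {ε : ℝ}

lemma IsPseudorandom.pos {d : ℕ} (hR : IsPseudorandom R d ε) (hε : ε < 1) : 0 < N := by
  rcases Nat.eq_zero_or_pos N with rfl | h
  · exfalso
    have h1 := hR 0 (by simp)
    have h2 := (Finset.single_le_sum (fun a _ => abs_nonneg _) (Finset.mem_univ (0 : F))).trans h1
    simp at h2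
    linarith
  · exact h

/-- The Schwartz–Zippel bound carries over to pseudorandom points. -/
lemma IsPseudorandom.le_card_eval_ne_zero {k d : ℕ} (hR : IsPseudorandom R k ε) (hε : ε < 1)
    (hd : d ≤ k) {p : MvPolynomial (Fin n) F} (hp : p ≠ 0) (hpd : p.totalDegree ≤ d) :
    (N : ℝ) * (1 - d / Fintype.card F - ε) ≤ hammingNorm fun t => MvPolynomial.eval (R t) p := by
  have hN : (0 : ℝ) < N := Nat.cast_pos.2 (hR.pos hε)
  have h1 := (Finset.single_le_sum (fun a _ => abs_nonneg _) (Finset.mem_univ (0 : F))).trans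
    (hR p (hpd.trans hd))
  have h2 : ((#{x : Fin n → F | MvPolynomial.eval x p = 0} : ℝ)) / (Fintype.card F : ℝ) ^ n ≤
      d / Fintype.card F := by
    have hsz := MvPolynomial.schwartz_zippel_totalDegree hp (Finset.univ : Finset F)
    rw [Fintype.piFinset_univ, Finset.card_univ] at hsz
    have hsz' := NNRat.cast_le (K := ℝ).2 hsz
    push_cast at hsz'
    refine hsz'.trans ?_
    gcongr
  have h3 : #{t | MvPolynomial.eval (R t) p = 0} +
      hammingNorm (fun t => MvPolynomial.eval (R t) p) = N := by
    have := Finset.card_filter_add_card_filter_not (s := (Finset.univ : Finset (Fin N)))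
      (fun t => MvPolynomial.eval (R t) p = 0)
    simpa [hammingNorm] using this
  have h3' : (#{t | MvPolynomial.eval (R t) p = 0} : ℝ) +
      hammingNorm (fun t => MvPolynomial.eval (R t) p) = N := by exact_mod_cast h3
  have h4 : (#{t | MvPolynomial.eval (R t) p = 0} : ℝ) / N ≤ d / Fintype.card F + ε := by
    have := (abs_le.1 h1).2
    linarith
  rw [div_le_iff₀ hN] at h4
  linarith

lemma IsPseudorandom.le_hammingNorm_of_mem_polyCode {k d : ℕ} (hR : IsPseudorandom R k ε)
    (hε : ε < 1) (hd : d ≤ k) {v : Fin N → F} (hv : v ∈ polyCode R d) (hne : v ≠ 0) :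
    (N : ℝ) * (1 - d / Fintype.card F - ε) ≤ hammingNorm v := by
  obtain ⟨p, hp, -, hpv⟩ := hv
  have hp0 : p ≠ 0 := by
    rintro rfl
    exact hne (funext fun t => by simp [hpv])
  have := hR.le_card_eval_ne_zero hε hd hp0 hp
  rwa [← funext hpv] at this

lemma lt_one_of_mul_card_lt_one {q : ℕ} {ε : ℝ} (hq : 1 ≤ q) (hε : ε * q < 1) : ε < 1 := by
  have hq' : (1 : ℝ) ≤ q := by exact_mod_cast hq
  by_contra! h
  nlinarith

/-- A polynomial of low degree that vanishes at all points of a pseudorandom multiset is zero. -/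
lemma IsPseudorandom.eq_zero_of_eval_eq_zero (hR : IsPseudorandom R (Fintype.card F - 1) ε)
    (hε : ε * Fintype.card F < 1) {p : MvPolynomial (Fin n) F}
    (hp : p.totalDegree ≤ Fintype.card F - 1) (h0 : ∀ t, MvPolynomial.eval (R t) p = 0) :
    p = 0 := by
  by_contra hne
  have hq : (1 : ℝ) ≤ Fintype.card F := by exact_mod_cast Fintype.card_pos (α := F)
  have hε' := lt_one_of_mul_card_lt_one Fintype.card_pos hε
  have h1 := hR.le_card_eval_ne_zero hε' le_rfl hne hp
  have h2 : hammingNorm (fun t => MvPolynomial.eval (R t) p) = 0 :=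
    hammingNorm_eq_zero.2 (funext h0)
  rw [h2, Nat.cast_zero, Nat.cast_sub Fintype.card_pos] at h1
  have hN : (0 : ℝ) < N := Nat.cast_pos.2 (hR.pos hε')
  have : 1 - ((Fintype.card F : ℝ) - (1 : ℕ)) / Fintype.card F - ε =
      (1 - ε * Fintype.card F) / Fintype.card F := by
    field_simp
    push_cast
    ring
  rw [this] at h1
  exact absurd h1 (not_le.2 (mul_pos hN (div_pos (by linarith) (by linarith))))

lemma IsPseudorandom.eq_zero_of_encode_eq_zero (hR : IsPseudorandom R (Fintype.card F - 1) ε)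
    (hε : ε * Fintype.card F < 1) {α : Fin n → F} (h : encode R α = 0) : α = 0 := by
  have h1 : 1 ≤ Fintype.card F - 1 := by
    have := Fintype.one_lt_card (α := F)
    omega
  have hp : (∑ i, MvPolynomial.C (α i) * MvPolynomial.X i : MvPolynomial (Fin n) F) = 0 := by
    refine hR.eq_zero_of_eval_eq_zero hε ((MvPolynomial.totalDegree_finsetSum_le
      fun i _ => ?_).trans h1) fun t => ?_
    · refine (MvPolynomial.totalDegree_mul _ _).trans ?_
      simp
    · have := congrFun h t
      simpa [encode] using this
  funext i
  have := congrArg (MvPolynomial.eval (Pi.single i 1)) hp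
  simpa [Pi.single_apply] using this

end Pseudorandom

/-! ### The minimum distance -/

section Arithmetic

variable {q : ℕ} {ε : ℝ}

lemma one_sub_le_mul_of_lt (hε : 0 ≤ ε) {d : ℕ} (hd : d < q) :
    1 - q * ε ≤ (d + 1 : ℝ) * (1 - d / q - ε) := by
  have hdq : (d : ℝ) + 1 ≤ q := by exact_mod_cast hd
  have hq : (0 : ℝ) < q := lt_of_lt_of_le (by positivity) hdq
  have h : (d + 1 : ℝ) * (1 - d / q - ε) - (1 - q * ε) =
      d * (q - 1 - d) / q + (q - (d + 1)) * ε := by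
    field_simp
    ring
  have h1 : (0 : ℝ) ≤ d * (q - 1 - d) / q :=
    div_nonneg (mul_nonneg (Nat.cast_nonneg _) (by linarith)) hq.le
  have h2 : (0 : ℝ) ≤ (q - (d + 1)) * ε := mul_nonneg (by linarith) hε
  linarith

/-- For `0 < d < q - 1` the relative weight of a polynomial of degree `d`, multiplied by the number
`d + 1` of non-zero values of a function whose first non-zero moment is the `d`-th, exceeds `1`. -/
lemma one_add_le_mul_of_lt (hε : 0 ≤ ε) {d : ℕ} (hd0 : 1 ≤ d) (hd : d + 2 ≤ q) :
    1 + 1 / q - q * ε ≤ (d + 1 : ℝ) * (1 - d / q - ε) := by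
  have hdq : (d : ℝ) + 2 ≤ q := by exact_mod_cast hd
  have hd1 : (1 : ℝ) ≤ d := by exact_mod_cast hd0
  have hq : (0 : ℝ) < q := by linarith
  have h : (d + 1 : ℝ) * (1 - d / q - ε) - (1 + 1 / q - q * ε) =
      (d * (q - 1 - d) - 1) / q + (q - (d + 1)) * ε := by
    field_simp
    ring
  have h1 : (0 : ℝ) ≤ (d * (q - 1 - d) - 1) / q := by
    refine div_nonneg ?_ hq.le
    nlinarith
  have h2 : (0 : ℝ) ≤ (q - (d + 1)) * ε := mul_nonneg (by linarith) hε
  linarith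

lemma mul_le_quarter (hq : 0 < q) (hε : ε ≤ 1 / (4 * (q : ℝ) ^ 2)) : q * ε ≤ 1 / (4 * q) := by
  have hq' : (0 : ℝ) < q := Nat.cast_pos.2 hq
  calc q * ε ≤ q * (1 / (4 * (q : ℝ) ^ 2)) := by gcongr
    _ = _ := by field_simp

lemma mul_card_lt_one (hq : 3 ≤ q) (hε : ε ≤ 1 / (4 * (q : ℝ) ^ 2)) : ε * q < 1 := by
  have h1 := mul_le_quarter (by omega) hε
  have h2 : (1 : ℝ) / (4 * q) < 1 := by
    have : (3 : ℝ) ≤ q := by exact_mod_cast hq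
    rw [div_lt_one (by linarith)]
    linarith
  linarith

lemma one_le_mul_one_sub (hq : 3 ≤ q) (hε0 : 0 ≤ ε) (hε : ε ≤ 1 / (4 * (q : ℝ) ^ 2)) :
    1 ≤ (1 + 1 / q - q * ε) * (1 - q * ε) := by
  have hq' : (3 : ℝ) ≤ q := by exact_mod_cast hq
  have ht := mul_le_quarter (by omega) hε
  have ht0 : 0 ≤ q * ε := by positivity
  have h1 : (1 : ℝ) / (4 * q) = 1 / q / 4 := by field_simp
  have h2 : (1 : ℝ) / q ≤ 1 / 3 := one_div_le_one_div_of_le (by norm_num) hq'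
  rw [h1] at ht
  nlinarith

/-- The product bound suffices as soon as one of the two exponents lies strictly between `0` and
`q - 1`. -/
lemma one_le_of_mid (hq : 3 ≤ q) (hε0 : 0 ≤ ε) (hε : ε ≤ 1 / (4 * (q : ℝ) ^ 2)) {e f : ℕ}
    (he : e < q) (hf : f < q) (h : (1 ≤ e ∧ e + 2 ≤ q) ∨ (1 ≤ f ∧ f + 2 ≤ q)) :
    1 ≤ ((e + 1) * (f + 1) : ℝ) * ((1 - e / q - ε) * (1 - f / q - ε)) := by
  have hq' : (3 : ℝ) ≤ q := by exact_mod_cast hq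
  have ht := mul_card_lt_one hq hε
  have hinv : (0 : ℝ) < 1 / q := by positivity
  have h1 := one_le_mul_one_sub hq hε0 hε
  have key : ∀ a b : ℝ, 1 + 1 / q - q * ε ≤ a → 1 - q * ε ≤ b → 1 ≤ a * b := fun a b ha hb =>
    h1.trans (mul_le_mul ha hb (by linarith) (by linarith))
  rcases h with h | h
  · calc (1 : ℝ) ≤ _ := key _ _ (one_add_le_mul_of_lt hε0 h.1 h.2) (one_sub_le_mul_of_lt hε0 hf)
      _ = _ := by ring
  · calc (1 : ℝ) ≤ _ := key _ _ (one_add_le_mul_of_lt hε0 h.1 h.2) (one_sub_le_mul_of_lt hε0 he)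
      _ = _ := by ring

lemma relWeight_nonneg (hq : 3 ≤ q) (hε : ε ≤ 1 / (4 * (q : ℝ) ^ 2)) {d : ℕ} (hd : d < q) :
    0 ≤ 1 - d / q - ε := by
  have hdq : (d : ℝ) + 1 ≤ q := by exact_mod_cast hd
  have hq' : (3 : ℝ) ≤ q := by exact_mod_cast hq
  have h : (1 : ℝ) - d / q - ε = (q - d - q * ε) / q := by field_simp
  have ht := mul_card_lt_one hq hε
  rw [h]
  exact div_nonneg (by linarith) (by linarith)

/-- The product bound for the exponents `(1, f)`, when only the weight `q` is available in place of
`2 * (f + 1)`. -/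
lemma one_le_card_mul (hq : 3 ≤ q) (hε0 : 0 ≤ ε) (hε : ε ≤ 1 / (4 * (q : ℝ) ^ 2)) {f : ℕ}
    (hf : f + 2 ≤ q) :
    1 ≤ (q : ℝ) * ((1 - (1 : ℕ) / q - ε) * (1 - f / q - ε)) := by
  have hq' : (3 : ℝ) ≤ q := by exact_mod_cast hq
  have hfq : (f : ℝ) + 2 ≤ q := by exact_mod_cast hf
  have ht := mul_le_quarter (by omega) hε
  have ht0 : 0 ≤ q * ε := by positivity
  have hqt : q * (q * ε) ≤ 1 / 4 := by
    calc q * (q * ε) ≤ q * (1 / (4 * q)) := by gcongr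
      _ = 1 / 4 := by field_simp
  have h : (q : ℝ) * ((1 - (1 : ℕ) / q - ε) * (1 - f / q - ε)) =
      (q - 1 - q * ε) * (q - f - q * ε) / q := by
    push_cast
    field_simp
  rw [h, le_div_iff₀ (by linarith), one_mul]
  have h1 : (q - 1 - q * ε) * (2 - q * ε) ≤ (q - 1 - q * ε) * (q - f - q * ε) :=
    mul_le_mul_of_nonneg_left (by linarith) (by nlinarith)
  nlinarith

lemma le_card_mul_sq (hq : 3 ≤ q) (hε0 : 0 ≤ ε) (hε : ε ≤ 1 / (4 * (q : ℝ) ^ 2)) :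
    q ≤ ((q : ℝ) + 1) * (q * (1 - (q - 1 : ℕ) / q - ε)) ^ 2 := by
  have hq' : (3 : ℝ) ≤ q := by exact_mod_cast hq
  have ht := mul_le_quarter (by omega) hε
  have ht0 : 0 ≤ q * ε := by positivity
  have h : (q : ℝ) * (1 - (q - 1 : ℕ) / q - ε) = 1 - q * ε := by
    rw [Nat.cast_sub (by omega)]
    field_simp
    push_cast
    ring
  have hqt : q * (q * ε) ≤ 1 / 4 := by
    calc q * (q * ε) ≤ q * (1 / (4 * q)) := by gcongr
      _ = 1 / 4 := by field_simp
  rw [h]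
  nlinarith [sq_nonneg (q * ε)]

end Arithmetic

lemma eq_zero_of_nand_sums {F : Type*} [Field F] {s : ZMod 2 → ZMod 2 → F} (h0 : 0 = ∑ a, ∑ b, s a b)
    (h1 : 0 = ∑ a, ∑ b, bit F a * s a b) (h2 : 0 = ∑ a, ∑ b, bit F b * s a b)
    (h3 : 0 = ∑ a, ∑ b, bit F (1 + a * b) * s a b) : s = 0 := by
  have hsum : ∀ g : ZMod 2 → F, ∑ a, g a = g 0 + g 1 := fun g => Fin.sum_univ_two g
  have b0 : bit F 0 = 0 := by simp [bit]
  have b1 : bit F 1 = 1 := by simp [bit, ZMod.val_one]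
  have b2 : (1 : ZMod 2) + 1 = 0 := by decide
  simp only [hsum, b0, b1, b2, mul_zero, zero_mul, mul_one, one_mul, zero_add, add_zero] at h0 h1 h2 h3
  have h11 : s 1 1 = 0 := by linear_combination h3 - h0
  have h10 : s 1 0 = 0 := by linear_combination -h1 - h11
  have h01 : s 0 1 = 0 := by linear_combination -h2 - h11
  have h00 : s 0 0 = 0 := by linear_combination -h0 - h11 - h10 - h01
  have hcase : ∀ a : ZMod 2, a = 0 ∨ a = 1 := by decide
  funext a b
  rcases hcase a with rfl | rfl <;> rcases hcase b with rfl | rfl <;> assumption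

section Distance

variable {F : Type*} [Field F] [Fintype F] {n N : ℕ} {R : Fin N → Fin n → F} {ε : ℝ} {Ψ : MaxNAND n}
  {V : Fin (2 * (Fintype.card F - 1) + 1) → Fin N → F}
  {Y : Fin (Fintype.card F) → Fin (Fintype.card F) → Matrix (Fin N) (Fin N) F}
  {Z : Fin N → Fin N → F → F → F} {S : Fin Ψ.m → ZMod 2 → ZMod 2 → F}

lemma Constraints.moment_eq (h : Constraints R Ψ V Y Z S) (i j : Fin N)
    (e f : Fin (Fintype.card F)) : moment (Z i j) e f = Y e f i j :=
  (h.prod_check i j e f).symm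

/-- The diagonal of `Y^{e,f}` depends on `e + f` only. -/
lemma Constraints.diag_eq (h : Constraints R Ψ V Y Z S) {e f e' f' : Fin (Fintype.card F)}
    (hsum : (e : ℕ) + f = e' + f') : (Y e f).diag = (Y e' f').diag := by
  have hlt : (e : ℕ) + f < 2 * (Fintype.card F - 1) + 1 := by omega
  rw [h.mat_diag e f ⟨_, hlt⟩ rfl, h.mat_diag e' f' ⟨_, hlt⟩ hsum]

/-- The diagonal of `Y^{q-1,q-1}` is that of `Y^{0,q-1}`. -/
lemma Constraints.diag_top_eq (h : Constraints R Ψ V Y Z S) {z t : Fin (Fintype.card F)}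
    (hz : (z : ℕ) = 0) (ht : (t : ℕ) = Fintype.card F - 1) : (Y t t).diag = (Y z t).diag := by
  have hq := Fintype.one_lt_card (α := F)
  rw [h.mat_diag t t ⟨2 * (Fintype.card F - 1), by omega⟩ (by simp only; omega),
    h.mat_diag z t ⟨Fintype.card F - 1, by omega⟩ (by simp only; omega)]
  exact h.vec_reduce _ _ (by simp only; omega) (by simp only; omega)

/-- A matrix with identical rows and zero diagonal vanishes. -/
lemma Constraints.eq_zero_of_rows (h : Constraints R Ψ V Y Z S) {z e : Fin (Fintype.card F)}
    (hz : (z : ℕ) = 0) (hd : (Y z e).diag = 0) : Y z e = 0 := by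
  ext i j
  rw [h.rows_eq z e hz i j j]
  exact congrFun hd j

/-- A matrix with identical columns and zero diagonal vanishes. -/
lemma Constraints.eq_zero_of_cols (h : Constraints R Ψ V Y Z S) {z e : Fin (Fintype.card F)}
    (hz : (z : ℕ) = 0) (hd : (Y e z).diag = 0) : Y e z = 0 := by
  ext i j
  rw [h.cols_eq e z hz i j i]
  exact congrFun hd i

variable [DecidableEq F]

lemma sum_weight_le_hammingNorm_proj (m r : ℕ) (w : Vars F N m) :
    ∑ i, ∑ j, weight (w.2.2.1 i j) ≤ hammingNorm (proj F N m r w) := by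
  rw [hammingNorm, Finset.card_filter, Fintype.sum_sum_type]
  refine le_trans (le_of_eq ?_) (Nat.le_add_right _ _)
  simp only [Fintype.sum_prod_type]
  refine Finset.sum_congr rfl fun i _ => Finset.sum_congr rfl fun j _ => ?_
  rw [Finset.sum_comm]
  simp only [weight, hammingNorm, Finset.card_filter]
  rfl

lemma mul_nnz_le_sum_weight (A : Matrix (Fin N) (Fin N) F) {m : ℝ}
    (h : ∀ i j, A i j ≠ 0 → m ≤ weight (Z i j)) :
    m * ∑ i, (hammingNorm (A i) : ℝ) ≤ ((∑ i, ∑ j, weight (Z i j) : ℕ) : ℝ) := by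
  push_cast
  rw [Finset.mul_sum]
  refine Finset.sum_le_sum fun i _ => ?_
  calc m * (hammingNorm (A i) : ℝ) = ∑ j with A i j ≠ 0, m := by
        rw [Finset.sum_const, nsmul_eq_mul, mul_comm]; rfl
    _ ≤ ∑ j with A i j ≠ 0, (weight (Z i j) : ℝ) :=
        Finset.sum_le_sum fun j hj => h i j (Finset.mem_filter.1 hj).2
    _ ≤ _ := Finset.sum_le_sum_of_subset_of_nonneg (Finset.filter_subset _ _)
        fun _ _ _ => Nat.cast_nonneg _

/-- The `Z_{ij}` and the `S_t` are determined by the matrices `Y^{e,f}`: the linear form encoded by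
`Y^1` is determined by its values at the pseudorandom points, and the four values of `S_t` by the
four equations for it. -/
lemma Constraints.eq_zero_of_mat_eq_zero (h : Constraints R Ψ V Y Z S)
    (hR : IsPseudorandom R (Fintype.card F - 1) ε) (hε : ε * Fintype.card F < 1)
    (hY : ∀ e f, Y e f = 0) : Z = 0 ∧ S = 0 := by
  have hq := Fintype.one_lt_card (α := F)
  have hN : 0 < N := hR.pos (lt_one_of_mul_card_lt_one hq.le hε)
  constructor
  · funext i j
    exact eq_zero_of_moment_eq_zero _ fun e he f hf => by
      rw [h.moment_eq i j ⟨e, he⟩ ⟨f, hf⟩, hY]; rfl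
  · obtain ⟨y₀, α, hy, hα, ht⟩ := h.nand_check
    have hy0 : y₀ = 0 := by
      rw [← hy ⟨0, by omega⟩ rfl ⟨0, hN⟩ ⟨0, hN⟩, hY]; rfl
    have hα0 : α = 0 := by
      refine hR.eq_zero_of_encode_eq_zero hε ?_
      rw [← hα ⟨1, by omega⟩ rfl, ← h.mat_diag ⟨0, by omega⟩ ⟨1, hq⟩ ⟨1, by omega⟩ rfl, hY]
      rfl
    subst hy0 hα0
    funext t
    obtain ⟨a0, a1, a2, a3⟩ := ht t
    exact eq_zero_of_nand_sums a0 a1 a2 a3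

/-- If every `Z_{ij}` above a non-zero entry of `Y^{e,f}` has weight at least `m`, and `m` makes up
for the relative weights of the two polynomial codes, then the total weight is at least `N ^ 2`. -/
lemma Constraints.sq_le_of_weight_le (h : Constraints R Ψ V Y Z S)
    (hR : IsPseudorandom R (Fintype.card F - 1) ε) (hq : 3 ≤ Fintype.card F)
    (hε : ε ≤ 1 / (4 * (Fintype.card F : ℝ) ^ 2)) {e f : Fin (Fintype.card F)} (hne : Y e f ≠ 0)
    {m : ℝ} (hm0 : 0 ≤ m) (hm : ∀ i j, Y e f i j ≠ 0 → m ≤ weight (Z i j))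
    (hbound : 1 ≤ m * ((1 - (e : ℕ) / (Fintype.card F : ℝ) - ε) *
      (1 - (f : ℕ) / (Fintype.card F : ℝ) - ε))) :
    N ^ 2 ≤ ∑ i, ∑ j, weight (Z i j) := by
  have hε1 := lt_one_of_mul_card_lt_one (by omega) (mul_card_lt_one hq hε)
  have hnnz := mul_le_nnz_of_mem_tensorCode
    (mul_nonneg (Nat.cast_nonneg N) (relWeight_nonneg hq hε f.2))
    (fun v hv hv0 => hR.le_hammingNorm_of_mem_polyCode hε1 (by omega) hv hv0)
    (fun v hv hv0 => hR.le_hammingNorm_of_mem_polyCode hε1 (by omega) hv hv0) (h.mat_mem e f) hne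
  have hsum := mul_nnz_le_sum_weight (Y e f) hm
  refine Nat.cast_le (α := ℝ).1 (le_trans ?_ hsum)
  refine le_trans ?_ (mul_le_mul_of_nonneg_left hnnz hm0)
  push_cast
  calc (N : ℝ) ^ 2 = (N : ℝ) ^ 2 * 1 := (mul_one _).symm
    _ ≤ (N : ℝ) ^ 2 * _ := mul_le_mul_of_nonneg_left hbound (sq_nonneg _)
    _ = _ := by ring

/-- The bound of `mul_le_weight_of_moment` in terms of the matrices `Y^{e,f}`. -/
lemma Constraints.mul_le_weight (h : Constraints R Ψ V Y Z S) {e f : Fin (Fintype.card F)}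
    {i j : Fin N} (h1 : ∀ e' < e, ∀ f', Y e' f' i j = 0) (h2 : ∀ f' < f, Y e f' i j = 0)
    (h3 : Y e f i j ≠ 0) : ((e : ℕ) + 1) * ((f : ℕ) + 1) ≤ weight (Z i j) := by
  refine mul_le_weight_of_moment _ (fun e' he' f' hf' => ?_) (fun f' hf' => ?_) ?_
  · rw [h.moment_eq i j ⟨e', he'.trans e.2⟩ ⟨f', hf'⟩]
    exact h1 _ he' _
  · rw [h.moment_eq i j e ⟨f', hf'.trans f.2⟩]
    exact h2 _ hf'
  · rwa [h.moment_eq i j e f]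

/-- The case that `Y^{0,q-1}` is the lexicographically first non-zero matrix. Its diagonal is then
that of `Y^{1,q-2}`, so that some `Y^{1,f}` with `0 < f < q - 1` does not vanish. -/
lemma Constraints.sq_le_of_zero_top (h : Constraints R Ψ V Y Z S)
    (hR : IsPseudorandom R (Fintype.card F - 1) ε) (hq : 3 ≤ Fintype.card F) (hε0 : 0 ≤ ε)
    (hε : ε ≤ 1 / (4 * (Fintype.card F : ℝ) ^ 2)) {z t : Fin (Fintype.card F)}
    (hz : (z : ℕ) = 0) (ht : (t : ℕ) = Fintype.card F - 1) (hne : Y z t ≠ 0)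
    (hlt : ∀ f < t, Y z f = 0) : N ^ 2 ≤ ∑ i, ∑ j, weight (Z i j) := by
  let o : Fin (Fintype.card F) := ⟨1, by omega⟩
  have ho : ∀ e < o, e = z := fun e he => by
    have : (e : ℕ) < 1 := he
    exact Fin.ext (by omega)
  have hp : Y o ⟨Fintype.card F - 2, by omega⟩ ≠ 0 := by
    intro h0
    refine hne (h.eq_zero_of_rows hz ?_)
    rw [h.diag_eq (e' := o) (f' := ⟨Fintype.card F - 2, by omega⟩) (by simp only [o]; omega), h0]
    rfl
  obtain ⟨f, hf, hmin⟩ := WellFounded.has_min (wellFounded_lt (α := Fin (Fintype.card F)))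
    {f | Y o f ≠ 0} ⟨_, hp⟩
  have hmin' : ∀ f' < f, Y o f' = 0 := fun f' hf' => by
    by_contra h0
    exact hmin f' h0 hf'
  have hf2 : (f : ℕ) + 2 ≤ Fintype.card F := by
    have : (f : ℕ) ≤ Fintype.card F - 2 := not_lt.1 (hmin _ hp)
    omega
  have hf1 : 1 ≤ (f : ℕ) := by
    by_contra! hlt1
    have hfz : f = z := Fin.ext (by omega)
    refine hf (hfz ▸ h.eq_zero_of_cols hz ?_)
    rw [h.diag_eq (e' := z) (f' := o) (by simp only [o]; omega), hlt o
      (Fin.lt_def.2 (by simp only [o]; omega))]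
    rfl
  have hw : ∀ i j, Y o f i j ≠ 0 →
      min (Fintype.card F : ℝ) ((1 + 1) * ((f : ℕ) + 1)) ≤ weight (Z i j) := fun i j hij => by
    by_cases hv : Y z t i j = 0
    · refine (min_le_right _ _).trans ?_
      have := h.mul_le_weight (e := o) (f := f) (i := i) (j := j) (fun e he f' => ?_)
        (fun f' hf' => by rw [hmin' f' hf']; rfl) hij
      · exact_mod_cast this
      · rw [ho e he]
        by_cases hf't : f' = t
        · rw [hf't, hv]
        · rw [hlt f' (lt_of_le_of_ne (Fin.le_def.2 (by omega)) hf't)]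
          rfl
    · refine (min_le_left _ _).trans (Nat.cast_le.2 ?_)
      have := h.mul_le_weight (e := z) (f := t) (i := i) (j := j)
        (fun e he => absurd (Fin.lt_def.1 he) (by omega)) (fun f' hf' => by rw [hlt f' hf']; rfl) hv
      rw [hz, ht] at this
      omega
  refine h.sq_le_of_weight_le hR hq hε hf (by positivity) hw ?_
  rcases min_choice (Fintype.card F : ℝ) ((1 + 1) * ((f : ℕ) + 1)) with hc | hc <;> rw [hc]
  · exact one_le_card_mul hq hε0 hε hf2
  · have := one_le_of_mid hq hε0 hε o.2 f.2 (Or.inr ⟨hf1, hf2⟩)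
    simpa only [o, Nat.cast_one] using this

/-- The case that only `Y^{q-1,q-1}` is non-zero. All `Z_{ij}` are then zero or nowhere zero, and
the matrix is symmetric with zero diagonal. -/
lemma Constraints.sq_le_of_top_top (h : Constraints R Ψ V Y Z S)
    (hR : IsPseudorandom R (Fintype.card F - 1) ε) (hq : 3 ≤ Fintype.card F) (hε0 : 0 ≤ ε)
    (hε : ε ≤ 1 / (4 * (Fintype.card F : ℝ) ^ 2)) {t : Fin (Fintype.card F)}
    (ht : (t : ℕ) = Fintype.card F - 1) (hne : Y t t ≠ 0)
    (h1 : ∀ e < t, ∀ f, Y e f = 0) (h2 : ∀ f < t, Y t f = 0) :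
    N ^ 2 ≤ ∑ i, ∑ j, weight (Z i j) := by
  have hε1 := lt_one_of_mul_card_lt_one (by omega) (mul_card_lt_one hq hε)
  have hw : ∀ i j, Y t t i j ≠ 0 → (Fintype.card F : ℝ) ^ 2 ≤ weight (Z i j) := fun i j hij => by
    have := h.mul_le_weight (i := i) (j := j) (fun e he f => by rw [h1 e he f]; rfl)
      (fun f hf => by rw [h2 f hf]; rfl) hij
    rw [ht, Nat.sub_add_cancel (by omega), ← sq] at this
    exact_mod_cast this
  have hdiag : (Y t t).diag = 0 := by
    rw [h.diag_top_eq (z := ⟨0, by omega⟩) rfl ht, h1 _ (Fin.lt_def.2 (by simp only; omega))]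
    rfl
  set w : ℝ := N * (1 - ((Fintype.card F - 1 : ℕ) : ℝ) / Fintype.card F - ε) with hw_def
  have hnnz := mul_le_nnz_of_symm_of_diag_eq_zero (w := w)
    (mul_nonneg (Nat.cast_nonneg N) (relWeight_nonneg hq hε (by omega)))
    (fun v hv hv0 => hR.le_hammingNorm_of_mem_polyCode hε1 le_rfl (ht ▸ hv) hv0) (h.mat_mem t t)
    hne (h.mat_symm t ht) hdiag
  have hsum := mul_nnz_le_sum_weight (Y t t) hw
  have hbound := le_card_mul_sq hq hε0 hε
  refine Nat.cast_le (α := ℝ).1 (le_trans ?_ hsum)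
  have hqpos : (0 : ℝ) < Fintype.card F := by positivity
  refine le_of_mul_le_mul_left ?_ hqpos
  push_cast
  calc (Fintype.card F : ℝ) * N ^ 2
      ≤ ((Fintype.card F + 1) * (Fintype.card F *
        (1 - ((Fintype.card F - 1 : ℕ) : ℝ) / Fintype.card F - ε)) ^ 2) * N ^ 2 := by gcongr
    _ = (Fintype.card F : ℝ) ^ 2 * ((Fintype.card F + 1) * w * w) := by rw [hw_def]; ring
    _ ≤ (Fintype.card F : ℝ) ^ 2 * (Fintype.card F * ∑ i, (hammingNorm (Y t t i) : ℝ)) := by gcongr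
    _ = _ := by ring

lemma Constraints.sq_le_sum_weight (h : Constraints R Ψ V Y Z S)
    (hR : IsPseudorandom R (Fintype.card F - 1) ε) (hq : 3 ≤ Fintype.card F) (hε0 : 0 ≤ ε)
    (hε : ε ≤ 1 / (4 * (Fintype.card F : ℝ) ^ 2)) (hne : ∃ e f, Y e f ≠ 0) :
    N ^ 2 ≤ ∑ i, ∑ j, weight (Z i j) := by
  obtain ⟨e, ⟨f₀, hf₀⟩, hmine⟩ := WellFounded.has_min (wellFounded_lt (α := Fin (Fintype.card F)))
    {e | ∃ f, Y e f ≠ 0} hne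
  obtain ⟨f, hf, hminf⟩ := WellFounded.has_min (wellFounded_lt (α := Fin (Fintype.card F)))
    {f | Y e f ≠ 0} ⟨f₀, hf₀⟩
  have h1 : ∀ e' < e, ∀ f', Y e' f' = 0 := fun e' he' f' => by
    by_contra h0
    exact hmine e' ⟨f', h0⟩ he'
  have h2 : ∀ f' < f, Y e f' = 0 := fun f' hf' => by
    by_contra h0
    exact hminf f' h0 hf'
  have hf : Y e f ≠ 0 := hf
  by_cases hmid : (1 ≤ (e : ℕ) ∧ (e : ℕ) + 2 ≤ Fintype.card F) ∨
      (1 ≤ (f : ℕ) ∧ (f : ℕ) + 2 ≤ Fintype.card F)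
  · refine h.sq_le_of_weight_le hR hq hε hf (m := ((e : ℕ) + 1) * ((f : ℕ) + 1)) (by positivity)
      (fun i j hij => ?_) (one_le_of_mid hq hε0 hε e.2 f.2 hmid)
    exact_mod_cast h.mul_le_weight (fun e' he' f' => by rw [h1 e' he' f']; rfl)
      (fun f' hf' => by rw [h2 f' hf']; rfl) hij
  have hlt_e := e.2
  have hlt_f := f.2
  rcases Nat.eq_zero_or_pos (e : ℕ) with he0 | he0 <;>
    rcases Nat.eq_zero_or_pos (f : ℕ) with hf0 | hf0
  -- `Y^{0,0}` is a non-zero constant, so no `Z_{ij}` vanishes.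
  · have hef : f = e := Fin.ext (by omega)
    subst hef
    obtain ⟨i₀, hi₀⟩ := Function.ne_iff.1 hf
    obtain ⟨j₀, hj₀⟩ := Function.ne_iff.1 hi₀
    have hall : ∀ i j, Z i j ≠ 0 := fun i j h0 => by
      refine hj₀ ?_
      rw [h.rows_eq f f he0 i₀ i j₀, h.cols_eq f f he0 i j₀ j, ← h.moment_eq, h0]
      simp [moment]
    calc N ^ 2 = ∑ _i : Fin N, ∑ _j : Fin N, 1 := by simp [sq]
      _ ≤ _ := Finset.sum_le_sum fun i _ => Finset.sum_le_sum fun j _ => one_le_weight (hall i j)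
  · exact h.sq_le_of_zero_top hR hq hε0 hε he0 (by omega) hf h2
  -- `Y^{q-1,0}` has identical columns and the diagonal of `Y^{0,q-1} = 0`.
  · refine absurd (h.eq_zero_of_cols hf0 ?_) hf
    rw [h.diag_eq (e' := f) (f' := e) (by omega), h1 f (Fin.lt_def.2 (by omega))]
    rfl
  · have hef : f = e := Fin.ext (by omega)
    subst hef
    exact h.sq_le_of_top_top hR hq hε0 hε (by omega) hf h1 h2

lemma sq_le_distance_finalCode (Ψ : MaxNAND n) (r : ℕ)
    (hR : IsPseudorandom R (Fintype.card F - 1) ε) (hq : 3 ≤ Fintype.card F) (hε0 : 0 ≤ ε)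
    (hε : ε ≤ 1 / (4 * (Fintype.card F : ℝ) ^ 2)) :
    ((N ^ 2 : ℕ) : ℕ∞) ≤ distance (finalCode R Ψ r) := by
  refine le_iInf₂ fun w hw => ?_
  obtain ⟨⟨⟨V, Y, Z, S⟩, hc, rfl⟩, hne⟩ := hw
  have hc : Constraints R Ψ V Y Z S := hc
  refine Nat.cast_le.2 (le_trans (hc.sq_le_sum_weight hR hq hε0 hε ?_)
    (sum_weight_le_hammingNorm_proj _ r (V, Y, Z, S)))
  by_contra! hY
  obtain ⟨rfl, rfl⟩ := hc.eq_zero_of_mat_eq_zero hR (mul_card_lt_one hq hε) hY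
  refine hne (funext fun c => ?_)
  rcases c with c | c <;> rfl

end Distance

/-! ### Symmetric matrices with zero diagonal and the dimension -/

section Dimension

variable {F : Type*} [Field F] {N : ℕ}

/-- The symmetric matrices with zero diagonal all of whose rows lie in `C`. -/
def symmZeroDiag (C : Submodule F (Fin N → F)) : Submodule F (Matrix (Fin N) (Fin N) F) where
  carrier := {Y | Y.transpose = Y ∧ Y.diag = 0 ∧ ∀ i, Y i ∈ C}
  add_mem' := by
    rintro A B ⟨a1, a2, a3⟩ ⟨b1, b2, b3⟩
    exact ⟨by rw [Matrix.transpose_add, a1, b1], by rw [Matrix.diag_add, a2, b2, add_zero],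
      fun i => C.add_mem (a3 i) (b3 i)⟩
  zero_mem' := ⟨rfl, rfl, fun _ => C.zero_mem⟩
  smul_mem' := by
    rintro c A ⟨a1, a2, a3⟩
    exact ⟨by rw [Matrix.transpose_smul, a1], by rw [Matrix.diag_smul, a2, smul_zero],
      fun i => C.smul_mem c (a3 i)⟩

/-- For two families in `C` that are jointly linearly independent, the matrices
`∑ B a b • (u a ⊗ v b + v b ⊗ u a)` form a space of symmetric matrices of dimension `h ^ 2`, and the vanishing of the diagonal
imposes `N` linear conditions on it. -/
lemma sq_le_finrank_symmZeroDiag_add (C : Submodule F (Fin N → F)) {h : ℕ}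
    {u v : Fin h → Fin N → F} (hu : ∀ a, u a ∈ C) (hv : ∀ b, v b ∈ C)
    (hind : LinearIndependent F (Sum.elim u v)) :
    h ^ 2 ≤ Module.finrank F (symmZeroDiag C) + N := by
  let U : Matrix (Fin h) (Fin N) F := Matrix.of u
  let W : Matrix (Fin h) (Fin N) F := Matrix.of v
  have hrow : ∀ (M : Matrix (Fin N) (Fin h) F) (w : Fin h → Fin N → F) (i : Fin N),
      (M * (Matrix.of w : Matrix (Fin h) (Fin N) F)) i = ∑ b, M i b • w b := fun M w i => by
    ext j
    simp [Matrix.mul_apply]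
  let Φ : Matrix (Fin h) (Fin h) F →ₗ[F] Matrix (Fin N) (Fin N) F :=
    { toFun := fun B => U.transpose * B * W + W.transpose * B.transpose * U
      map_add' := fun B B' => by
        simp only [Matrix.transpose_add, Matrix.mul_add, Matrix.add_mul]
        abel
      map_smul' := fun c B => by
        simp only [Matrix.transpose_smul, Matrix.mul_smul, Matrix.smul_mul, smul_add,
          RingHom.id_apply] }
  have hΦ : ∀ B, Φ B = U.transpose * B * W + W.transpose * B.transpose * U := fun B => rfl
  have hinj : Function.Injective Φ := by
    rw [injective_iff_map_eq_zero]
    intro B hB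
    have hUB : ∀ i b, (U.transpose * B) i b = 0 := fun i b => by
      have hi : (Φ B) i = 0 := by rw [hB]; rfl
      have hsum : ∑ s, Sum.elim ((W.transpose * B.transpose) i) ((U.transpose * B) i) s •
          Sum.elim u v s = 0 := by
        rw [Fintype.sum_sum_type]
        simp only [Sum.elim_inl, Sum.elim_inr]
        rw [← hrow, ← hrow, add_comm]
        exact hi
      exact Fintype.linearIndependent_iff.1 hind _ hsum (Sum.inr b)
    have hu' : LinearIndependent F u := hind.comp Sum.inl Sum.inl_injective
    ext a b
    refine Fintype.linearIndependent_iff.1 hu' (fun a => B a b) ?_ a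
    ext i
    rw [Pi.zero_apply, ← hUB i b, Matrix.mul_apply, Finset.sum_apply]
    exact Finset.sum_congr rfl fun a _ => mul_comm _ _
  let G : Matrix (Fin h) (Fin h) F →ₗ[F] (Fin N → F) := (Matrix.diagLinearMap (Fin N) F F).comp Φ
  have hle : (LinearMap.ker G).map Φ ≤ symmZeroDiag C := by
    rintro _ ⟨B, hB, rfl⟩
    refine ⟨?_, hB, fun i => ?_⟩
    · rw [hΦ, Matrix.transpose_add]
      simp only [Matrix.transpose_mul, Matrix.transpose_transpose, Matrix.mul_assoc]
      rw [add_comm]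
    · rw [hΦ]
      refine C.add_mem (x := (U.transpose * B * W) i) (y := (W.transpose * B.transpose * U) i) ?_ ?_
      · rw [hrow]
        exact C.sum_mem fun b _ => C.smul_mem _ (hv b)
      · rw [hrow]
        exact C.sum_mem fun a _ => C.smul_mem _ (hu a)
  have h1 := Submodule.finrank_mono hle
  rw [← (Submodule.equivMapOfInjective Φ hinj (LinearMap.ker G)).finrank_eq] at h1
  have h2 := G.finrank_range_add_finrank_ker
  have h3 : Module.finrank F (LinearMap.range G) ≤ N := by
    simpa using Submodule.finrank_le (LinearMap.range G)
  rw [Module.finrank_matrix, Module.finrank_self, Fintype.card_fin, mul_one, ← sq] at h2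
  omega

variable [Fintype F]

/-- The final codeword all of whose `Z_{ij}` are constant, with value `Y i j`, and all of whose
`S_t` vanish. -/
def constWord (F : Type*) [Field F] [Fintype F] (N m r : ℕ) :
    Matrix (Fin N) (Fin N) F →ₗ[F] (Coord F N m r → F) where
  toFun Y := Sum.elim (fun c => Y c.1 c.2.1) 0
  map_add' Y Y' := by
    funext c
    rcases c with c | c
    · rfl
    · exact (add_zero (0 : F)).symm
  map_smul' a Y := by
    funext c
    rcases c with c | c
    · rfl
    · exact (mul_zero a).symm

lemma sum_pow_card_sub_one (F : Type*) [Field F] [Fintype F] :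
    ∑ x : F, x ^ (Fintype.card F - 1) = -1 := by
  classical
  have hq := Fintype.one_lt_card (α := F)
  have h : ∀ x : F, x ^ (Fintype.card F - 1) = 1 - if x = 0 then 1 else 0 := fun x => by
    split_ifs with hx
    · rw [hx, zero_pow (by omega), sub_self]
    · rw [FiniteField.pow_card_sub_one_eq_one x hx, sub_zero]
  simp [h]

lemma constWord_injective (m r : ℕ) : Function.Injective (constWord F N m r) := fun Y Y' h => by
  ext i j
  exact congrFun h (Sum.inl (i, j, 0, 0))

/-- A symmetric matrix with zero diagonal and rows in `P_{q-1}` may serve as `Y^{q-1,q-1}` when all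
other `Y^{e,f}` vanish: the moments of a constant function vanish except for the exponents
`(q - 1, q - 1)`. -/
lemma map_constWord_le_finalCode {n : ℕ} (R : Fin N → Fin n → F) (Ψ : MaxNAND n) (r : ℕ)
    (hq : 3 ≤ Fintype.card F) :
    (symmZeroDiag (polyCode R (Fintype.card F - 1))).map (constWord F N Ψ.m r) ≤
      finalCode R Ψ r := by
  rintro _ ⟨A, ⟨hsymm, hdiag, hrow⟩, rfl⟩
  let t : ℕ := Fintype.card F - 1
  let Y : Fin (Fintype.card F) → Fin (Fintype.card F) → Matrix (Fin N) (Fin N) F :=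
    fun e f => if (e : ℕ) = t ∧ (f : ℕ) = t then A else 0
  have hcol : ∀ j, (fun i => A i j) ∈ polyCode R (Fintype.card F - 1) := fun j => by
    rw [← hsymm]
    exact hrow j
  have hYne : ∀ e f : Fin (Fintype.card F), ¬((e : ℕ) = t ∧ (f : ℕ) = t) → Y e f = 0 :=
    fun e f hef => if_neg hef
  have hYdiag : ∀ e f, (Y e f).diag = 0 := fun e f => by
    by_cases hef : (e : ℕ) = t ∧ (f : ℕ) = t
    · simp only [Y, if_pos hef, hdiag]
    · rw [hYne e f hef]; rfl
  refine ⟨(0, Y, fun i j _ _ => A i j, 0), ?_, ?_⟩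
  · change Constraints R Ψ 0 Y (fun i j _ _ => A i j) 0
    refine ⟨fun e _ => Submodule.zero_mem _, fun _ _ _ _ => rfl, fun e f => ?_,
      fun e f g _ => hYdiag e f, fun z e hz i i' j => ?_, fun e z hz i j j' => ?_, fun e he => ?_,
      ⟨0, 0, fun z hz i j => ?_, fun e _ => ?_, fun s => ?_⟩, fun i j e f => ?_⟩
    · by_cases hef : (e : ℕ) = t ∧ (f : ℕ) = t
      · simp only [Y, if_pos hef]
        rw [hef.1, hef.2]
        exact ⟨hcol, hrow⟩
      · rw [hYne e f hef]
        exact Submodule.zero_mem _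
    · rw [hYne z e (by omega)]; rfl
    · rw [hYne e z (by omega)]; rfl
    · simp only [Y, if_pos (show (e : ℕ) = t ∧ (e : ℕ) = t from ⟨he, he⟩), hsymm]
    · rw [hYne z z (by omega)]; rfl
    · funext s
      simp [encode]
    · simp
    · have hpow : ∀ e : Fin (Fintype.card F),
          ∑ x : F, x ^ (e : ℕ) = if (e : ℕ) = t then -1 else 0 := fun e => by
        split_ifs with he
        · rw [he]
          exact sum_pow_card_sub_one F
        · exact FiniteField.sum_pow_lt_card_sub_one F e (by have := e.2; omega)
      have hmul : ∑ x : F, ∑ y : F, x ^ (e : ℕ) * y ^ (f : ℕ) * A i j =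
          ((∑ x : F, x ^ (e : ℕ)) * ∑ y : F, y ^ (f : ℕ)) * A i j := by
        rw [Finset.sum_mul_sum, Finset.sum_mul]
        exact Finset.sum_congr rfl fun x _ => (Finset.sum_mul _ _ _).symm
      rw [hmul, hpow e, hpow f]
      by_cases he : (e : ℕ) = t <;> by_cases hf : (f : ℕ) = t <;> simp [Y, he, hf]
  · funext c
    rcases c with c | c <;> rfl

lemma finrank_symmZeroDiag_le {n : ℕ} (R : Fin N → Fin n → F) (Ψ : MaxNAND n) (r : ℕ)
    (hq : 3 ≤ Fintype.card F) :
    Module.finrank F (symmZeroDiag (polyCode R (Fintype.card F - 1))) ≤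
      Module.finrank F (finalCode R Ψ r) := by
  rw [(Submodule.equivMapOfInjective _ (constWord_injective Ψ.m r) _).finrank_eq]
  exact Submodule.finrank_mono (map_constWord_le_finalCode R Ψ r hq)

end Dimension

section Existence

section Monomials

variable {F : Type*} [Field F] {n N : ℕ}

/-- The values of the monomial with multiset of variables `s` at the points of `R`. -/
noncomputable def monomialWord (R : Fin N → Fin n → F) {d : ℕ} (s : Sym (Fin n) d) : Fin N → F :=
  fun t => MvPolynomial.eval (R t)
    (MvPolynomial.monomial (Multiset.toFinsupp (s : Multiset (Fin n))) 1)

lemma totalDegree_monomial_toFinsupp_le {d : ℕ} (s : Sym (Fin n) d) (c : F) :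
    (MvPolynomial.monomial (Multiset.toFinsupp (s : Multiset (Fin n))) c).totalDegree ≤ d := by
  refine (MvPolynomial.totalDegree_monomial_le _ _).trans ?_
  exact (Multiset.toFinsupp_sum_eq (s : Multiset (Fin n))).le.trans s.2.le

lemma monomialWord_mem_polyCode (R : Fin N → Fin n → F) {d : ℕ} (hd : 1 ≤ d) (s : Sym (Fin n) d) :
    monomialWord R s ∈ polyCode R d := by
  refine ⟨_, totalDegree_monomial_toFinsupp_le s 1, fun _ => ?_, fun t => rfl⟩
  have hs : Multiset.toFinsupp (s : Multiset (Fin n)) ≠ 0 := fun h0 => by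
    have h1 : (s : Multiset (Fin n)) = 0 := by simpa using h0
    have h2 : Multiset.card (s : Multiset (Fin n)) = d := s.2
    rw [h1, Multiset.card_zero] at h2
    omega
  rw [MvPolynomial.eval_zero, MvPolynomial.constantCoeff_monomial, if_neg hs]

end Monomials

variable {F : Type*} [Field F] [Fintype F] [DecidableEq F] {n N : ℕ} {R : Fin N → Fin n → F}
  {ε : ℝ}

/-- It is the word of the polynomial `1 - (X k - a) ^ (q - 1)`; its constant term vanishes as `a ≠ 0`. -/
lemma indicator_mem_polyCode (R : Fin N → Fin n → F) (k : Fin n) {a : F} (ha : a ≠ 0) :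
    (fun t => if R t k = a then (1 : F) else 0) ∈ polyCode R (Fintype.card F - 1) := by
  have hq := Fintype.one_lt_card (α := F)
  have heval : ∀ x : Fin n → F, MvPolynomial.eval x
      (1 - (MvPolynomial.X k - MvPolynomial.C a) ^ (Fintype.card F - 1)) =
        if x k = a then (1 : F) else 0 := fun x => by
    split_ifs with h
    · simp [h, show Fintype.card F - 1 ≠ 0 by omega]
    · simp [FiniteField.pow_card_sub_one_eq_one _ (sub_ne_zero.2 h)]
  refine ⟨_, ?_, fun _ => ?_, fun t => (heval (R t)).symm⟩
  · refine (MvPolynomial.totalDegree_sub _ _).trans (max_le (by simp) ?_)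
    refine (MvPolynomial.totalDegree_pow _ _).trans ?_
    refine (Nat.mul_le_mul_left _ ((MvPolynomial.totalDegree_sub _ _).trans
      (max_le (MvPolynomial.totalDegree_X k).le (by simp)))).trans (mul_one _).le
  · rw [heval, if_neg (by simpa using ha.symm)]

lemma IsPseudorandom.exists_apply_eq (hR : IsPseudorandom R (Fintype.card F - 1) ε)
    (hε : ε * Fintype.card F < 1) (k : Fin n) (a : F) : ∃ t, R t k = a := by
  by_contra! h
  have hq := Fintype.one_lt_card (α := F)
  have h0 := hR.eq_zero_of_eval_eq_zero hε
    (p := 1 - (MvPolynomial.X k - MvPolynomial.C a) ^ (Fintype.card F - 1)) ?_ fun t => by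
      simp [FiniteField.pow_card_sub_one_eq_one _ (sub_ne_zero.2 (h t))]
  · have := congrArg (MvPolynomial.eval fun _ => a) h0
    simp [show Fintype.card F - 1 ≠ 0 by omega] at this
  · refine (MvPolynomial.totalDegree_sub _ _).trans (max_le (by simp) ?_)
    refine (MvPolynomial.totalDegree_pow _ _).trans ?_
    refine (Nat.mul_le_mul_left _ ((MvPolynomial.totalDegree_sub _ _).trans
      (max_le (MvPolynomial.totalDegree_X k).le (by simp)))).trans (mul_one _).le

/-- For `q ≥ 3` there are two non-zero field elements; the indicators of two parallel hyperplanes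
missing the origin have disjoint supports, and their symmetrised tensor product is a non-zero
symmetric matrix with zero diagonal. -/
lemma one_le_finrank_symmZeroDiag (hR : IsPseudorandom R (Fintype.card F - 1) ε)
    (hε : ε * Fintype.card F < 1) (hq : 3 ≤ Fintype.card F) (hn : 0 < n) :
    1 ≤ Module.finrank F (symmZeroDiag (polyCode R (Fintype.card F - 1))) := by
  let k : Fin n := ⟨0, hn⟩
  obtain ⟨b, hb⟩ : ∃ b : F, b ∉ ({0, 1} : Finset F) := by
    by_contra! hall
    have h1 : (Finset.univ : Finset F).card ≤ ({0, 1} : Finset F).card :=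
      Finset.card_le_card fun x _ => hall x
    have h2 : ({0, 1} : Finset F).card ≤ 2 := Finset.card_le_two
    rw [Finset.card_univ] at h1
    omega
  simp only [Finset.mem_insert, Finset.mem_singleton, not_or] at hb
  let u : Fin N → F := fun t => if R t k = 1 then 1 else 0
  let v : Fin N → F := fun t => if R t k = b then 1 else 0
  have hu : u ∈ polyCode R (Fintype.card F - 1) := indicator_mem_polyCode R k one_ne_zero
  have hv : v ∈ polyCode R (Fintype.card F - 1) := indicator_mem_polyCode R k hb.1
  have hmem : (Matrix.of fun i j => u i * v j + v i * u j) ∈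
      symmZeroDiag (polyCode R (Fintype.card F - 1)) := by
    refine ⟨?_, ?_, fun i => ?_⟩
    · ext i j
      simp only [Matrix.transpose_apply, Matrix.of_apply]
      ring
    · ext i
      have : u i * v i = 0 := by
        by_cases h : R i k = 1
        · simp [v, h, Ne.symm hb.2]
        · simp [u, h]
      simp only [Matrix.diag_apply, Matrix.of_apply, Pi.zero_apply]
      rw [mul_comm (v i), this, add_zero]
    · exact Submodule.add_mem _ (Submodule.smul_mem _ (u i) hv) (Submodule.smul_mem _ (v i) hu)
  obtain ⟨s, hs⟩ := hR.exists_apply_eq hε k 1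
  obtain ⟨t, ht⟩ := hR.exists_apply_eq hε k b
  rw [Nat.one_le_iff_ne_zero, ← Nat.pos_iff_ne_zero, Module.finrank_pos_iff_exists_ne_zero]
  refine ⟨⟨_, hmem⟩, fun h0 => ?_⟩
  have := congrFun (congrFun (congrArg Subtype.val h0) s) t
  simp [u, v, hs, ht, hb.2] at this

lemma linearIndependent_monomialWord (hR : IsPseudorandom R (Fintype.card F - 1) ε)
    (hε : ε * Fintype.card F < 1) :
    LinearIndependent F (monomialWord R (d := Fintype.card F - 1)) := by
  rw [Fintype.linearIndependent_iff]
  intro g hg s₀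
  have hp : ∑ s : Sym (Fin n) (Fintype.card F - 1),
      MvPolynomial.monomial (Multiset.toFinsupp (s : Multiset (Fin n))) (g s) = 0 := by
    refine hR.eq_zero_of_eval_eq_zero hε (MvPolynomial.totalDegree_finsetSum_le
      fun s _ => totalDegree_monomial_toFinsupp_le s _) fun t => ?_
    have := congrFun hg t
    simpa [monomialWord, MvPolynomial.eval_monomial] using this
  have := congrArg (MvPolynomial.coeff (Multiset.toFinsupp (s₀ : Multiset (Fin n)))) hp
  rw [MvPolynomial.coeff_sum, Finset.sum_eq_single s₀] at this
  · simpa using this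
  · intro s _ hs
    rw [MvPolynomial.coeff_monomial, if_neg]
    exact fun h => hs (Sym.coe_injective (Multiset.toFinsupp.injective h))
  · simp

lemma pow_le_factorial_mul_card_sym (n d : ℕ) :
    n ^ d ≤ d.factorial * Fintype.card (Sym (Fin n) d) := by
  rw [Sym.card_sym_eq_multichoose, Fintype.card_fin, Nat.multichoose_eq,
    ← Nat.ascFactorial_eq_factorial_mul_choose']
  exact Nat.pow_succ_le_ascFactorial n d

/-- With `h` half the number of monomials of degree `q - 1`. -/
lemma exists_sq_le_finrank_symmZeroDiag_add (hR : IsPseudorandom R (Fintype.card F - 1) ε)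
    (hε : ε * Fintype.card F < 1) :
    ∃ h : ℕ, n ^ (Fintype.card F - 1) ≤ (Fintype.card F - 1).factorial * (2 * h + 1) ∧
      h ^ 2 ≤ Module.finrank F (symmZeroDiag (polyCode R (Fintype.card F - 1))) + N := by
  have hq := Fintype.one_lt_card (α := F)
  set k := Fintype.card (Sym (Fin n) (Fintype.card F - 1)) with hk
  refine ⟨k / 2, (pow_le_factorial_mul_card_sym n _).trans (Nat.mul_le_mul_left _ (by omega)), ?_⟩
  obtain ⟨f⟩ : Nonempty (Fin (k / 2) ⊕ Fin (k / 2) ↪ Sym (Fin n) (Fintype.card F - 1)) :=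
    Function.Embedding.nonempty_of_card_le (by
      rw [Fintype.card_sum, Fintype.card_fin, ← hk]
      omega)
  refine sq_le_finrank_symmZeroDiag_add (u := fun a => monomialWord R (f (Sum.inl a)))
    (v := fun b => monomialWord R (f (Sum.inr b))) _
    (fun a => monomialWord_mem_polyCode R (by omega) _)
    (fun b => monomialWord_mem_polyCode R (by omega) _) ?_
  have hcomp : Sum.elim (fun a => monomialWord R (f (Sum.inl a)))
      (fun b => monomialWord R (f (Sum.inr b))) = monomialWord R ∘ f := by
    funext s
    rcases s with s | s <;> rfl
  rw [hcomp]
  exact (linearIndependent_monomialWord hR hε).comp f f.injective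

/-- The constant of the dimension bound, where `L * k` bounds the length `N` in terms of the number
`k` of monomials. -/
noncomputable def dimConst (L : ℝ) : ℝ :=
  min (1 / (32 * L ^ 2)) (1 / (2 * L + 32 * L ^ 2) ^ 2)

lemma dimConst_pos {L : ℝ} (hL : 0 < L) : 0 < dimConst L :=
  lt_min (by positivity) (by positivity)

/-- For `x` below `2 * L + 32 * L ^ 2` the bound `1 ≤ D` suffices; beyond it the linear loss `x` is
absorbed by half of the quadratic term. -/
lemma dimConst_mul_sq_le {L x h D : ℝ} (hL : 0 < L) (hx : 0 ≤ x) (hxh : x ≤ L * (2 * h + 1))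
    (hD1 : 1 ≤ D) (hD2 : h ^ 2 ≤ D + x) : dimConst L * x ^ 2 ≤ D := by
  rcases le_total x (2 * L + 32 * L ^ 2) with hsmall | hlarge
  · calc dimConst L * x ^ 2 ≤ 1 / (2 * L + 32 * L ^ 2) ^ 2 * (2 * L + 32 * L ^ 2) ^ 2 := by
          gcongr
          exact min_le_right _ _
      _ = 1 := by field_simp
      _ ≤ D := hD1
  · have h4 : x / (4 * L) ≤ h := by
      rw [div_le_iff₀ (by positivity)]
      nlinarith [sq_nonneg L]
    have h5 : (x / (4 * L)) ^ 2 ≤ h ^ 2 := by gcongr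
    have h6 : x ≤ x ^ 2 / (32 * L ^ 2) := by
      rw [le_div_iff₀ (by positivity), sq x]
      gcongr
      linarith
    have h7 : (x / (4 * L)) ^ 2 = 1 / (32 * L ^ 2) * x ^ 2 + x ^ 2 / (32 * L ^ 2) := by
      field_simp
      ring
    calc dimConst L * x ^ 2 ≤ 1 / (32 * L ^ 2) * x ^ 2 := by
          gcongr
          exact min_le_left _ _
      _ ≤ D := by linarith

lemma dimConst_mul_sq_le_finrank_finalCode {K : ℝ} (hK : 0 < K) (Ψ : MaxNAND n) (r : ℕ)
    (hR : IsPseudorandom R (Fintype.card F - 1) ε) (hε : ε * Fintype.card F < 1)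
    (hq : 3 ≤ Fintype.card F) (hN : (N : ℝ) ≤ K * (n : ℝ) ^ (Fintype.card F - 1)) :
    dimConst (K * (Fintype.card F - 1).factorial) * (N : ℝ) ^ 2 ≤
      Module.finrank F (finalCode R Ψ r) := by
  have hNpos : 0 < N := hR.pos (lt_one_of_mul_card_lt_one (by omega) hε)
  have hn : 0 < n := by
    rcases Nat.eq_zero_or_pos n with rfl | h
    · rw [Nat.cast_zero, zero_pow (by omega), mul_zero] at hN
      exact absurd hN (not_le.2 (Nat.cast_pos.2 hNpos))
    · exact h
  obtain ⟨h, h1, h2⟩ := exists_sq_le_finrank_symmZeroDiag_add hR hε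
  have h3 := one_le_finrank_symmZeroDiag hR hε hq hn
  refine le_trans ?_ (Nat.cast_le.2 (finrank_symmZeroDiag_le R Ψ r hq))
  refine dimConst_mul_sq_le (h := h) (by positivity) (Nat.cast_nonneg N) ?_ (by exact_mod_cast h3)
    (by exact_mod_cast h2)
  rw [mul_assoc]
  exact hN.trans (mul_le_mul_of_nonneg_left (by exact_mod_cast h1) hK.le)

end Existence

end GoodCode

theorem mainTheorem4 (q : ℕ) (hq : 3 ≤ q) :
    ∃ ε₀ : ℝ, 0 < ε₀ ∧ ∀ K : ℝ, 0 < K → ∃ c : ℝ, 0 < c ∧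
      ∀ (F : Type*) [Field F] [Fintype F] [DecidableEq F], Fintype.card F = q →
      ∀ ε : ℝ, 0 < ε → ε ≤ ε₀ →
      ∀ (n N : ℕ) (R : Fin N → Fin n → F),
        GoodCode.IsPseudorandom R (q - 1) ε → (N : ℝ) ≤ K * (n : ℝ) ^ (q - 1) →
      ∀ (Ψ : GoodCode.MaxNAND n) (r : ℕ), 1 ≤ r →
        c * (N : ℝ) ^ 2 ≤ (Module.finrank F (GoodCode.finalCode R Ψ r) : ℝ) ∧
        ((N ^ 2 : ℕ) : ℕ∞) ≤ GoodCode.distance (GoodCode.finalCode R Ψ r) := by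
  refine ⟨1 / (4 * (q : ℝ) ^ 2), by positivity, fun K hK =>
    ⟨GoodCode.dimConst (K * (q - 1).factorial), GoodCode.dimConst_pos (by positivity), ?_⟩⟩
  intro F _ _ _ hF ε hε0 hε n N R hR hN Ψ r _
  subst hF
  exact ⟨GoodCode.dimConst_mul_sq_le_finrank_finalCode hK Ψ r hR
    (GoodCode.mul_card_lt_one hq hε) hq hN,
    GoodCode.sq_le_distance_finalCode Ψ r hR hq hε0.le hε⟩
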